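/- For $n\ge 1$ and $X=(x_1,\dots,x_n)\in\{0,1\}^n$ let $\mathrm{Par}(X)=x_1\oplus\cdots\oplus x_n$. For $\varepsilon>0$, an algorithm that accepts $X$ (outputs $1$) with probability $p(X)$ solves $\mathrm{WeakPar}_{n,\varepsilon}$ if $|p(X)-\mathrm{Par}(X)|\le \tfrac13$ for at least $(\tfrac12+\varepsilon)2^n$ of the inputs $X\in\{0,1\}^n$. Let $\mathrm{R}_2(\mathrm{WeakPar}_{n,\varepsilon})$ be the least number $T$ such that some randomized query algorithm (a probability distribution over Boolean decision trees) that makes at most $T$ queries on every input in $\{0,1\}^n$, for every outcome of its randomness, solves $\mathrm{WeakPar}_{n,\varepsilon}$. Let $\mathrm{Q}_2(\mathrm{WeakPar}_{n,\varepsilon})$ be the least $T$ such that some quantum query algorithm with $T$ queries $|i,b,z\rangle\mapsto|i,b\oplus x_i,z\rangle$ (arbitrary finite-dimensional workspace $z$, arbitrary input-independent unitaries before, between and after the queries, output obtained by measuring the workspace at the end) solves $\mathrm{WeakPar}_{n,\varepsilon}$. Both are $+\infty$ if no such algorithm exists. Let $$\Lambda(n)=\min_{G\subseteq\{0,1\}^n,\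 |G|=2^{n-1}+1}\Delta(G),$$ where $\Delta(G)$ is the maximum degree of the subgraph induced on $G$ of the Boolean hypercube graph (two strings are adjacent iff their Hamming distance is $1$). Then there is a constant $c>0$ such that for all integers $n\ge1$ and all $\varepsilon>0$, $$\mathrm{R}_2(\mathrm{WeakPar}_{n,\varepsilon})\ \ge\ c\,\Lambda(n),\qquad \mathrm{Q}_2(\mathrm{WeakPar}_{n,\varepsilon})\ \ge\ c\,\sqrt{\Lambda(n)}.$$ Moreover, for all $n\ge2$, $$\Lambda(n)\ \ge\ \tfrac12\log_2 n-\tfrac12\log_2\log_2 n+\tfrac12 ,$$ and there is a constant $c'>0$ such that for all $n\ge1$ and all $\varepsilon>0$, $$\mathrm{R}_2(\mathrm{WeakPar}_{n,\varepsilon})\ \ge\ c'\log n,\qquad \mathrm{Q}_2(\mathrm{WeakPar}_{n,\varepsilon})\ \ge\ c'\sqrt{\log n}.$$ -/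

import Mathlib

namespace WeakParity

/-- Inputs: Boolean strings `X = (x₁, …, xₙ) ∈ {0,1}ⁿ`. -/
abbrev Input (n : ℕ) : Type := Fin n → Bool

/-- The parity `x₁ ⊕ ⋯ ⊕ xₙ`, as a number in `{0, 1}`. -/
def par {n : ℕ} (X : Input n) : ℕ := (∑ i, (X i).toNat) % 2

/-- The success condition of Weak Parity, for an algorithm with acceptance probabilities `p`:
the set of inputs `X` with `|p(X) - Par(X)| ≤ 1/3` has at least `(1/2 + ε) 2ⁿ` elements. -/
def SolvesWeakPar {n : ℕ} (ε : ℝ) (p : Input n → ℝ) : Prop :=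
  (1 / 2 + ε) * 2 ^ n ≤ (Set.ncard {X : Input n | |p X - (par X : ℝ)| ≤ 1 / 3} : ℝ)

/-! ### Randomized query algorithms -/

/-- Deterministic query algorithms on `n` bits: decision trees with Boolean outputs.
`query i t₀ t₁` reads `xᵢ` and continues with `t₀` if `xᵢ = 0` and with `t₁` if `xᵢ = 1`. -/
inductive DecisionTree (n : ℕ) : Type
  | leaf (output : Bool) : DecisionTree n
  | query (i : Fin n) (t₀ t₁ : DecisionTree n) : DecisionTree n

/-- The output of a decision tree on the input `X`. -/
def DecisionTree.eval {n : ℕ} (X : Input n) : DecisionTree n → Bool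
  | .leaf b => b
  | .query i t₀ t₁ => if X i then t₁.eval X else t₀.eval X

/-- The number of queries that a decision tree makes on the input `X`. -/
def DecisionTree.numQueries {n : ℕ} (X : Input n) : DecisionTree n → ℕ
  | .leaf _ => 0
  | .query i t₀ t₁ => (if X i then t₁.numQueries X else t₀.numQueries X) + 1

/-- A randomized query algorithm: a probability distribution over decision trees. -/
abbrev RandomizedAlg (n : ℕ) : Type := PMF (DecisionTree n)

/-- The probability that the randomized algorithm outputs `1` on the input `X`. -/
noncomputable def RandomizedAlg.acceptProb {n : ℕ} (R : RandomizedAlg n) (X : Input n) : ℝ :=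
  ((R.map (DecisionTree.eval X)) true).toReal

/-- The number of queries of a randomized algorithm: worst case over the inputs and over the
random choices of positive probability. -/
noncomputable def RandomizedAlg.cost {n : ℕ} (R : RandomizedAlg n) : ℕ∞ :=
  ⨆ t ∈ R.support, ⨆ X : Input n, (t.numQueries X : ℕ∞)

/-- `R₂(WeakPar_{n,ε})`, equal to `⊤` if no algorithm succeeds (as when `ε > 1/2`). -/
noncomputable def R2 (n : ℕ) (ε : ℝ) : ℕ∞ :=
  ⨅ (R : RandomizedAlg n) (_ : SolvesWeakPar ε R.acceptProb), R.cost

/-! ### Quantum query algorithms -/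

/-- Computational basis states `|i, b, z⟩`, with a workspace register `z` of dimension `d`. -/
abbrev BasisState (n d : ℕ) : Type := Fin n × Bool × Fin d

/-- The query transformation, i.e. the linear map with `|i, b, z⟩ ↦ |i, b ⊕ xᵢ, z⟩`, on vectors
of amplitudes (this permutation of the basis states is its own inverse). -/
def oracle {n d : ℕ} (X : Input n) (ψ : BasisState n d → ℂ) : BasisState n d → ℂ :=
  fun s => ψ (s.1, xor s.2.1 (X s.1), s.2.2)

/-- A quantum query algorithm with `T` queries. It starts in the basis state `start`, applies
`U 0`, and then alternates queries with the input-independent unitaries `U 1, …, U T`.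
The output is read off from a final measurement of the workspace register. -/
structure QuantumAlg (n : ℕ) where
  /-- the dimension of the workspace -/
  d : ℕ
  /-- the number of queries -/
  T : ℕ
  /-- the initial basis state -/
  start : BasisState n d
  /-- the unitaries; only those with index at most `T` are used -/
  U : ℕ → Matrix.unitaryGroup (BasisState n d) ℂ
  /-- the output when the measured content of the workspace is `z` -/
  out : Fin d → Bool

/-- The state `U_k O_X U_{k-1} ⋯ O_X U_0 |start⟩`, after `k` queries to `X`. -/
noncomputable def QuantumAlg.state {n : ℕ} (A : QuantumAlg n) (X : Input n) :
    ℕ → BasisState n A.d → ℂ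
  | 0 => (A.U 0).val.mulVec (Pi.single A.start 1)
  | k + 1 => (A.U (k + 1)).val.mulVec (oracle X (A.state X k))

/-- The probability that the quantum algorithm outputs `1` on the input `X`. -/
noncomputable def QuantumAlg.acceptProb {n : ℕ} (A : QuantumAlg n) (X : Input n) : ℝ :=
  ∑ s : BasisState n A.d, if A.out s.2.2 then ‖A.state X A.T s‖ ^ 2 else 0

/-- `Q₂(WeakPar_{n,ε})`, equal to `⊤` if no algorithm succeeds (as when `ε > 1/2`). -/
noncomputable def Q2 (n : ℕ) (ε : ℝ) : ℕ∞ :=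
  ⨅ (A : QuantumAlg n) (_ : SolvesWeakPar ε A.acceptProb), (A.T : ℕ∞)

/-! ### Induced subgraphs of the hypercube -/

/-- The Boolean hypercube graph: adjacency is Hamming distance `1`. -/
def cube (n : ℕ) : SimpleGraph (Input n) where
  Adj X Y := hammingDist X Y = 1
  symm := ⟨fun X Y h => by rwa [hammingDist_comm]⟩
  loopless := ⟨fun X h => by simp at h⟩

open Classical in
/-- `Δ(G)`: the maximum degree of the subgraph of the hypercube induced on `G`. -/
noncomputable def maxDeg {n : ℕ} (G : Finset (Input n)) : ℕ :=
  ((cube n).induce (G : Set (Input n))).maxDegree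

/-- `Λ(n)`: the minimum of `Δ(G)` over the sets `G` of `2^{n-1} + 1` vertices. It is meant for
`n ≥ 1`; such sets then exist and the infimum of natural numbers is attained. -/
noncomputable def Lambda (n : ℕ) : ℕ :=
  sInf {k : ℕ | ∃ G : Finset (Input n), G.card = 2 ^ (n - 1) + 1 ∧ maxDeg G = k}

end WeakParity

namespace WeakParity

/-! If `p` is within 1/3 of parity on more than half of the cube, choose 2^(n-1)+1 such inputs as
`G`. Some `X` in `G` has at least Λ(n) neighbours in `G`. Parity changes along each edge, so `p`
jumps by at least 1/3 in Λ(n) directions at `X` (`SolvesWeakPar.exists_sensitive`). Randomized: a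
jump in direction `i` is at most the probability of reading bit `i` on `X`, and these probabilities
sum to at most the cost. Quantum: the hybrid argument bounds a jump by the amplitude placed on
queries to `i`; Cauchy–Schwarz over time gives |S| ≤ (12T)² (`card_le_of_sensitive`). The
logarithmic bounds on Λ(n) follow from Huang's stronger √n ≤ Λ(n) and the elementary inequality
log₂(2x) ≤ 2√x. -/

open Finset

/-- The input obtained from `X` by flipping the bit `i`. -/
def flip {n : ℕ} (X : Input n) (i : Fin n) : Input n := Function.update X i (!X i)

/-! ### Bit flips, induced degrees and parity -/

section Flip

variable {n : ℕ}

@[simp] lemma flip_self (X : Input n) (i : Fin n) : flip X i i = !X i := by simp [flip]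

lemma flip_of_ne (X : Input n) {i j : Fin n} (h : j ≠ i) : flip X i j = X j := by
  simp [flip, h]

@[simp] lemma flip_flip (X : Input n) (i : Fin n) : flip (flip X i) i = X := by
  ext j
  by_cases h : j = i
  · subst h; simp
  · simp [flip_of_ne _ h]

lemma flip_comm (X : Input n) (i j : Fin n) : flip (flip X i) j = flip (flip X j) i := by
  ext k
  by_cases hi : k = i <;> by_cases hj : k = j <;> grind [flip_self, flip_of_ne]

lemma flip_injective (X : Input n) : Function.Injective (flip X) := by
  intro i j h
  by_contra hij
  have := congrFun h i
  rw [flip_self, flip_of_ne X hij] at this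
  simp at this

lemma cube_adj_iff (X Y : Input n) : (cube n).Adj X Y ↔ ∃ i, flip X i = Y := by
  change hammingDist X Y = 1 ↔ _
  rw [hammingDist, card_eq_one]
  constructor
  · rintro ⟨i, hi⟩
    refine ⟨i, funext fun j => ?_⟩
    have hj := congrArg (j ∈ ·) hi
    simp only [mem_filter, mem_univ, true_and, mem_singleton, eq_iff_iff] at hj
    by_cases h : j = i
    · subst h
      have := hj.2 rfl
      rw [flip_self]
      revert this
      cases X j <;> cases Y j <;> simp
    · rw [flip_of_ne _ h]
      by_contra h'
      exact h (hj.1 h')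
  · rintro ⟨i, rfl⟩
    refine ⟨i, ?_⟩
    ext j
    by_cases h : j = i
    · subst h; simp
    · simp [flip_of_ne _ h, h]

open Classical in
lemma degree_induce_cube (G : Finset (Input n)) (X : (G : Set (Input n))) :
    ((cube n).induce (G : Set (Input n))).degree X = #{i | flip X i ∈ G} := by
  rw [← SimpleGraph.card_neighborFinset_eq_degree]
  symm
  refine card_bij (fun i hi => ⟨flip X i, by simpa using hi⟩) ?_ ?_ ?_
  · intro i hi
    simp only [SimpleGraph.mem_neighborFinset, SimpleGraph.comap_adj]
    exact (cube_adj_iff _ _).2 ⟨i, rfl⟩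
  · intro i _ j _ h
    exact flip_injective X (congrArg Subtype.val h)
  · rintro ⟨Y, hY⟩ h
    simp only [SimpleGraph.mem_neighborFinset, SimpleGraph.comap_adj] at h
    obtain ⟨i, hi⟩ := (cube_adj_iff _ _).1 h
    refine ⟨i, ?_, Subtype.ext hi⟩
    simp only [mem_filter, mem_univ, true_and]
    exact hi ▸ hY

open Classical in
lemma card_flip_le_maxDeg {G : Finset (Input n)} {X : Input n} (hX : X ∈ G) :
    #{i | flip X i ∈ G} ≤ maxDeg G := by
  have h := ((cube n).induce (G : Set (Input n))).degree_le_maxDegree ⟨X, hX⟩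
  rwa [degree_induce_cube] at h

open Classical in
lemma exists_card_flip_eq_maxDeg {G : Finset (Input n)} (hG : G.Nonempty) :
    ∃ X ∈ G, #{i | flip X i ∈ G} = maxDeg G := by
  have : Nonempty (G : Set (Input n)) := hG.to_subtype
  obtain ⟨X, hX⟩ := ((cube n).induce (G : Set (Input n))).exists_maximal_degree_vertex
  exact ⟨X, X.2, by rw [← degree_induce_cube]; exact hX.symm⟩

lemma Lambda_le_maxDeg {G : Finset (Input n)} (hG : G.card = 2 ^ (n - 1) + 1) :
    Lambda n ≤ maxDeg G :=
  Nat.sInf_le ⟨G, hG, rfl⟩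

lemma exists_maxDeg_eq_Lambda (hn : 1 ≤ n) :
    ∃ G : Finset (Input n), G.card = 2 ^ (n - 1) + 1 ∧ maxDeg G = Lambda n := by
  refine Nat.sInf_mem (s := {k | ∃ G : Finset (Input n), G.card = 2 ^ (n - 1) + 1 ∧ maxDeg G = k})
    ?_
  have h : 2 ^ (n - 1) + 1 ≤ #(univ : Finset (Input n)) := by
    obtain ⟨m, rfl⟩ := Nat.exists_eq_add_of_le' hn
    have := Nat.one_le_two_pow (n := m)
    simp only [card_univ, Fintype.card_fun, Fintype.card_bool, Fintype.card_fin,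
      Nat.add_sub_cancel, pow_succ]
    omega
  obtain ⟨G, -, hG⟩ := exists_subset_card_eq h
  exact ⟨_, G, hG, rfl⟩

/-- Flipping a bit flips the parity. -/
lemma par_flip (X : Input n) (i : Fin n) : par (flip X i) = 1 - par X := by
  have h : ∀ Y : Input n, ∑ j, (Y j).toNat = (Y i).toNat + ∑ j ∈ univ.erase i, (Y j).toNat :=
    fun Y => (add_sum_erase _ _ (mem_univ i)).symm
  have h' : ∑ j ∈ univ.erase i, (flip X i j).toNat = ∑ j ∈ univ.erase i, (X j).toNat :=
    sum_congr rfl fun j hj => by rw [flip_of_ne _ (ne_of_mem_erase hj)]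
  rw [par, par, h, h X, h', flip_self]
  cases X i <;> simp <;> omega

lemma par_lt_two (X : Input n) : par X < 2 := Nat.mod_lt _ two_pos

end Flip

/-! ### Huang's sensitivity theorem -/

section Sensitivity

variable {n : ℕ}

/-- The sign of the edge in direction `i` at `X`: the parity of the bits before `i`. -/
def edgeSign (X : Input n) (i : Fin n) : ℝ := ∏ j ∈ Iio i, if X j then -1 else 1

lemma edgeSign_flip_of_le (X : Input n) {i j : Fin n} (h : i ≤ j) :
    edgeSign (flip X j) i = edgeSign X i :=
  prod_congr rfl fun k hk => by
    rw [flip_of_ne _ ((mem_Iio.1 hk).trans_le h).ne]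

lemma edgeSign_flip_of_lt (X : Input n) {i j : Fin n} (h : j < i) :
    edgeSign (flip X j) i = -edgeSign X i := by
  rw [edgeSign, edgeSign, ← mul_prod_erase _ _ (mem_Iio.2 h),
    ← mul_prod_erase _ (fun k => if X k then (-1 : ℝ) else 1) (mem_Iio.2 h),
    prod_congr rfl fun k hk => by rw [flip_of_ne _ (ne_of_mem_erase hk)]]
  cases hX : X j <;> simp [hX]

lemma edgeSign_mul_self (X : Input n) (i : Fin n) : edgeSign X i * edgeSign X i = 1 := by
  rw [edgeSign, ← prod_mul_distrib]
  exact prod_eq_one fun j _ => by split_ifs <;> norm_num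

lemma abs_edgeSign (X : Input n) (i : Fin n) : |edgeSign X i| = 1 := by
  rw [edgeSign, abs_prod]
  exact prod_eq_one fun j _ => by split_ifs <;> norm_num

/-- The signed adjacency operator of the hypercube. -/
def signedAdj (n : ℕ) : (Input n → ℝ) →ₗ[ℝ] (Input n → ℝ) where
  toFun f X := ∑ i, edgeSign X i * f (flip X i)
  map_add' f g := by ext X; simp [mul_add, sum_add_distrib]
  map_smul' c f := by ext X; simp [mul_sum, mul_left_comm]

lemma signedAdj_apply (f : Input n → ℝ) (X : Input n) :
    signedAdj n f X = ∑ i, edgeSign X i * f (flip X i) := rfl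

/-- The square sums over two-step walks. For `i ≠ j`, flipping the smaller index negates the sign of
the larger direction but not conversely, so the two orders cancel. Only the `n` walks returning to
`X` survive. -/
lemma signedAdj_signedAdj (f : Input n → ℝ) : signedAdj n (signedAdj n f) = (n : ℝ) • f := by
  ext X
  let g : Fin n → Fin n → ℝ := fun i j =>
    edgeSign X i * (edgeSign (flip X i) j * f (flip (flip X i) j))
  have hg : ∀ i j, g i j + g j i = if i = j then 2 * f X else 0 := by
    have key : ∀ i j, i < j → g i j + g j i = 0 := fun i j hij => by
      simp only [g]
      rw [edgeSign_flip_of_lt X hij, edgeSign_flip_of_le X hij.le, flip_comm X i j]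
      ring
    intro i j
    rcases lt_trichotomy i j with h | rfl | h
    · rw [if_neg h.ne, key i j h]
    · have := edgeSign_mul_self X i
      simp only [g, edgeSign_flip_of_le X le_rfl, flip_flip, if_true]
      linear_combination 2 * f X * this
    · rw [if_neg h.ne', add_comm, key j i h]
  have h1 : signedAdj n (signedAdj n f) X = ∑ i, ∑ j, g i j := by
    simp only [signedAdj_apply, g, mul_sum]
  have h2 : ∑ i, ∑ j, g i j + ∑ i, ∑ j, g i j = 2 * (n * f X) := by
    nth_rewrite 2 [sum_comm]
    simp only [← sum_add_distrib, hg, sum_ite_eq, mem_univ, if_true]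
    simp
    ring
  rw [h1, Pi.smul_apply, smul_eq_mul]
  linarith

/-- Multiplication by the parity sign. -/
def paritySign (n : ℕ) : (Input n → ℝ) →ₗ[ℝ] (Input n → ℝ) where
  toFun f X := (1 - 2 * (par X : ℝ)) * f X
  map_add' f g := by ext X; simp [mul_add]
  map_smul' c f := by ext X; simp [mul_left_comm]

lemma paritySign_apply (f : Input n → ℝ) (X : Input n) :
    paritySign n f X = (1 - 2 * (par X : ℝ)) * f X := rfl

lemma paritySign_paritySign (f : Input n → ℝ) : paritySign n (paritySign n f) = f := by
  ext X
  have := par_lt_two X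
  simp only [paritySign_apply]
  interval_cases par X <;> norm_num

/-- Since the cube is bipartite, `paritySign` swaps the eigenspaces for √n and -√n; this replaces
the usual trace argument for their equal dimension. -/
lemma signedAdj_paritySign (f : Input n → ℝ) :
    signedAdj n (paritySign n f) = -paritySign n (signedAdj n f) := by
  ext X
  have := par_lt_two X
  simp only [signedAdj_apply, paritySign_apply, Pi.neg_apply, par_flip, mul_sum,
    ← sum_neg_distrib]
  refine sum_congr rfl fun i _ => ?_
  interval_cases par X <;> norm_num

/-- The eigenspace of the signed adjacency operator for the eigenvalue `√n`. -/
noncomputable def sqrtEigenspace (n : ℕ) : Submodule ℝ (Input n → ℝ) :=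
  LinearMap.ker (signedAdj n - (√(n : ℝ)) • LinearMap.id)

lemma mem_sqrtEigenspace (f : Input n → ℝ) :
    f ∈ sqrtEigenspace n ↔ signedAdj n f = √(n : ℝ) • f := by
  simp [sqrtEigenspace, sub_eq_zero]

lemma add_mem_sqrtEigenspace (f : Input n → ℝ) :
    √(n : ℝ) • f + signedAdj n f ∈ sqrtEigenspace n := by
  rw [mem_sqrtEigenspace, map_add, map_smul, signedAdj_signedAdj, smul_add, smul_smul,
    Real.mul_self_sqrt (Nat.cast_nonneg n), add_comm]

lemma paritySign_sub_mem_sqrtEigenspace (f : Input n → ℝ) :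
    paritySign n (√(n : ℝ) • f - signedAdj n f) ∈ sqrtEigenspace n := by
  rw [mem_sqrtEigenspace, signedAdj_paritySign, ← map_smul, ← map_neg]
  congr 1
  rw [map_sub, map_smul, signedAdj_signedAdj, smul_sub, smul_smul,
    Real.mul_self_sqrt (Nat.cast_nonneg n), neg_sub]

/-- Writing A for `signedAdj n`, 2√n f = (√n + A)f + (√n - A)f. The first term lies in the
eigenspace and the second in its image under `paritySign`, so two copies of the eigenspace cover
everything. -/
lemma two_pow_le_finrank_sqrtEigenspace (hn : 1 ≤ n) :
    2 ^ n ≤ 2 * Module.finrank ℝ (sqrtEigenspace n) := by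
  let φ : (sqrtEigenspace n × sqrtEigenspace n) →ₗ[ℝ] (Input n → ℝ) :=
    (sqrtEigenspace n).subtype.coprod (paritySign n ∘ₗ (sqrtEigenspace n).subtype)
  have hφ : Function.Surjective φ := fun f => by
    have h0 : 2 * √(n : ℝ) ≠ 0 := by positivity
    let u : sqrtEigenspace n := ⟨_, add_mem_sqrtEigenspace f⟩
    let v : sqrtEigenspace n := ⟨_, paritySign_sub_mem_sqrtEigenspace f⟩
    have h : φ (u, v) = (2 * √(n : ℝ)) • f := by
      simp only [φ, u, v, LinearMap.coprod_apply, LinearMap.comp_apply, Submodule.subtype_apply,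
        paritySign_paritySign]
      module
    exact ⟨(2 * √(n : ℝ))⁻¹ • (u, v), by rw [map_smul, h, inv_smul_smul₀ h0]⟩
  have h := LinearMap.finrank_le_finrank_of_surjective hφ
  rw [Module.finrank_prod, Module.finrank_fintype_fun_eq_card] at h
  simp only [Fintype.card_fun, Fintype.card_bool, Fintype.card_fin] at h
  omega

open Classical in
/-- **Huang's sensitivity theorem**. -/
theorem exists_sqrt_le_card_flip (hn : 1 ≤ n) {G : Finset (Input n)}
    (hG : 2 ^ (n - 1) < G.card) : ∃ X ∈ G, √(n : ℝ) ≤ #{i | flip X i ∈ G} := by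
  -- Restriction to the complement of `G`, which has fewer than 2^(n-1) points: its kernel yields a
  -- nonzero eigenvector supported on `G`.
  let ρ : sqrtEigenspace n →ₗ[ℝ] ((Gᶜ : Finset (Input n)) → ℝ) :=
    LinearMap.funLeft ℝ ℝ Subtype.val ∘ₗ (sqrtEigenspace n).subtype
  have hρ : LinearMap.ker ρ ≠ ⊥ := by
    apply LinearMap.ker_ne_bot_of_finrank_lt
    rw [Module.finrank_fintype_fun_eq_card, Fintype.card_coe, card_compl]
    have := two_pow_le_finrank_sqrtEigenspace hn
    simp only [Fintype.card_fun, Fintype.card_bool, Fintype.card_fin]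
    obtain ⟨m, rfl⟩ := Nat.exists_eq_add_of_le' hn
    rw [pow_succ] at *
    simp only [Nat.add_sub_cancel] at hG
    have := Nat.two_pow_pos m
    omega
  obtain ⟨⟨f, hf⟩, hfρ, hf0⟩ := Submodule.exists_mem_ne_zero_of_ne_bot hρ
  have hfG : ∀ Y ∉ G, f Y = 0 := fun Y hY =>
    congrFun (LinearMap.mem_ker.1 hfρ) ⟨Y, mem_compl.2 hY⟩
  -- At a maximum of |f|, the eigenvalue equation bounds √n |f X| by |f X| times the number of
  -- neighbours in `G`.
  obtain ⟨X, -, hX⟩ := exists_max_image univ (fun Y => |f Y|) univ_nonempty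
  have hfX : 0 < |f X| := by
    obtain ⟨Y, hY⟩ := Function.ne_iff.1 (fun h => hf0 (Subtype.ext h) : f ≠ 0)
    exact (abs_pos.2 hY).trans_le (hX Y (mem_univ _))
  refine ⟨X, by_contra fun h => hfX.ne' (by simp [hfG X h]), ?_⟩
  refine le_of_mul_le_mul_right ?_ hfX
  calc √(n : ℝ) * |f X| = |signedAdj n f X| := by
        rw [(mem_sqrtEigenspace f).1 hf, Pi.smul_apply, smul_eq_mul, abs_mul,
          abs_of_nonneg (Real.sqrt_nonneg _)]
    _ ≤ ∑ i, |f (flip X i)| := by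
        rw [signedAdj_apply]
        exact (abs_sum_le_sum_abs _ _).trans_eq (by simp [abs_mul, abs_edgeSign])
    _ ≤ ∑ i, if flip X i ∈ G then |f X| else 0 := sum_le_sum fun i _ => by
        split_ifs with h
        · exact hX _ (mem_univ _)
        · simp [hfG _ h]
    _ = #{i | flip X i ∈ G} * |f X| := by
        rw [← sum_filter, sum_const, nsmul_eq_mul]

theorem sqrt_le_Lambda (hn : 1 ≤ n) : √(n : ℝ) ≤ Lambda n := by
  classical
  obtain ⟨G, hG, hGΛ⟩ := exists_maxDeg_eq_Lambda hn
  obtain ⟨X, hX, h⟩ := exists_sqrt_le_card_flip hn (G := G) (by omega)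
  rw [← hGΛ]
  exact h.trans (by exact_mod_cast card_flip_le_maxDeg hX)

end Sensitivity

/-! ### Sensitive inputs of algorithms for Weak Parity -/

section Sensitive

variable {n : ℕ}

open Classical in
/-- An algorithm for Weak Parity changes its acceptance probability by at least `1/3`
in at least `Λ(n)` directions from some input. -/
lemma SolvesWeakPar.exists_sensitive (hn : 1 ≤ n) {ε : ℝ} (hε : 0 < ε) {p : Input n → ℝ}
    (hp : SolvesWeakPar ε p) :
    ∃ (X : Input n) (S : Finset (Fin n)), Lambda n ≤ #S ∧
      ∀ i ∈ S, 1 / 3 ≤ |p X - p (flip X i)| := by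
  let H : Finset (Input n) := {X | |p X - (par X : ℝ)| ≤ 1 / 3}
  have hH : 2 ^ (n - 1) + 1 ≤ #H := by
    have h : (1 / 2 + ε) * 2 ^ n ≤ (#H : ℝ) := by
      rw [← Set.ncard_coe_finset]
      simpa [SolvesWeakPar, H] using hp
    obtain ⟨m, rfl⟩ := Nat.exists_eq_add_of_le' hn
    rw [Nat.add_sub_cancel, Nat.add_one_le_iff]
    have h2 : (2 : ℝ) ^ m < #H := by
      refine lt_of_lt_of_le ?_ h
      -- Positivity of ε makes the inequality strict, which gives the extra vertex beyond half.
      have : (0 : ℝ) < ε * 2 ^ (m + 1) := by positivity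
      rw [add_mul, pow_succ]
      rw [pow_succ] at this
      linarith
    exact_mod_cast h2
  obtain ⟨G, hGH, hG⟩ := exists_subset_card_eq hH
  obtain ⟨X, hX, hdeg⟩ := exists_card_flip_eq_maxDeg (G := G) (card_pos.1 (hG ▸ Nat.succ_pos _))
  refine ⟨X, ({i | flip X i ∈ G} : Finset (Fin n)), hdeg ▸ Lambda_le_maxDeg hG, fun i hi => ?_⟩
  have h1 : |p X - (par X : ℝ)| ≤ 1 / 3 := by simpa [H] using hGH hX
  have h2 : |p (flip X i) - (par (flip X i) : ℝ)| ≤ 1 / 3 := by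
    simpa [H] using hGH (by simpa using hi)
  have h3 := par_lt_two X
  rw [par_flip] at h2
  rw [abs_le] at h1 h2
  rw [le_abs]
  -- Of the two acceptance probabilities, one is at most 1/3 and the other at least 2/3.
  interval_cases par X
  · right; norm_num at h1 h2; linarith [h1.2, h2.1]
  · left; norm_num at h1 h2; linarith [h1.1, h2.2]

end Sensitive

/-! ### The randomized lower bound -/

section Randomized

variable {n : ℕ}

/-- The set of the bits that a decision tree reads on the input `X`. -/
def DecisionTree.queried (X : Input n) : DecisionTree n → Finset (Fin n)
  | .leaf _ => ∅
  | .query i t₀ t₁ => insert i (if X i then t₁.queried X else t₀.queried X)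

lemma DecisionTree.card_queried_le (X : Input n) (t : DecisionTree n) :
    #(t.queried X) ≤ t.numQueries X := by
  induction t with
  | leaf b => simp [queried]
  | query i t₀ t₁ h₀ h₁ =>
    simp only [queried, numQueries]
    refine (card_insert_le _ _).trans ?_
    split_ifs <;> omega

lemma DecisionTree.eval_flip (X : Input n) {i : Fin n} (t : DecisionTree n)
    (h : i ∉ t.queried X) : t.eval (flip X i) = t.eval X := by
  induction t with
  | leaf b => rfl
  | query j t₀ t₁ h₀ h₁ =>
    simp only [queried, mem_insert, not_or] at h
    simp only [eval, flip_of_ne X (Ne.symm h.1)]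
    by_cases hX : X j
    · simp only [hX, if_true] at h ⊢
      exact h₁ h.2
    · simp only [hX] at h ⊢
      exact h₀ h.2

open Classical in
/-- The probability that a randomized algorithm reads the bit `i` of the input `X`. -/
noncomputable def RandomizedAlg.queryProb (R : RandomizedAlg n) (X : Input n) (i : Fin n) :
    ENNReal :=
  ∑' t, if i ∈ t.queried X then R t else 0

/-- Trees not reading `i` on `Z` contribute equally; each other tree costs at most its mass. The
separate `Z` allows both directions of the comparison to trace the run on the same input. -/
lemma RandomizedAlg.map_eval_le (R : RandomizedAlg n) (X Y Z : Input n) (i : Fin n)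
    (h : ∀ t : DecisionTree n, i ∉ t.queried Z → t.eval X = t.eval Y) :
    R.map (DecisionTree.eval X) true ≤ R.map (DecisionTree.eval Y) true + R.queryProb Z i := by
  classical
  simp only [PMF.map_apply, queryProb]
  rw [← ENNReal.tsum_add]
  refine ENNReal.tsum_le_tsum fun t => ?_
  by_cases hi : i ∈ t.queried Z
  · rw [if_pos hi]
    refine le_trans ?_ le_add_self
    split_ifs <;> simp
  · rw [h t hi]
    exact le_self_add

lemma RandomizedAlg.sum_queryProb_le (R : RandomizedAlg n) (X : Input n) (S : Finset (Fin n)) :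
    ∑ i ∈ S, R.queryProb X i ≤ (R.cost : ENNReal) := by
  classical
  simp only [queryProb]
  rw [← Summable.tsum_finsetSum fun i _ => ENNReal.summable]
  calc ∑' t, ∑ i ∈ S, (if i ∈ t.queried X then R t else 0)
      ≤ ∑' t, R t * (R.cost : ENNReal) := by
        refine ENNReal.tsum_le_tsum fun t => ?_
        rw [← sum_filter, sum_const, nsmul_eq_mul, mul_comm]
        -- The cost controls only trees of positive probability.
        by_cases ht : R t = 0
        · simp [ht]
        gcongr
        have h1 : #{i ∈ S | i ∈ t.queried X} ≤ t.numQueries X :=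
          (card_le_card fun i hi => (mem_filter.1 hi).2).trans (t.card_queried_le X)
        have h2 : (t.numQueries X : ℕ∞) ≤ R.cost :=
          (le_iSup (fun X => (t.numQueries X : ℕ∞)) X).trans
            (le_iSup₂ (f := fun t (_ : t ∈ R.support) => ⨆ X, (t.numQueries X : ℕ∞)) t
              ((R.mem_support_iff t).2 ht))
        have h3 : ((#{i ∈ S | i ∈ t.queried X} : ℕ) : ℕ∞) ≤ R.cost :=
          (Nat.cast_le.2 h1).trans h2
        exact_mod_cast ENat.toENNReal_le.2 h3
    _ = (R.cost : ENNReal) := by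
        rw [ENNReal.tsum_mul_right, R.tsum_coe, one_mul]

lemma RandomizedAlg.third_le_queryProb (R : RandomizedAlg n) (X : Input n) (i : Fin n)
    (h : 1 / 3 ≤ |R.acceptProb X - R.acceptProb (flip X i)|) :
    ENNReal.ofReal (1 / 3) ≤ R.queryProb X i := by
  have h1 := R.map_eval_le (flip X i) X X i fun t => t.eval_flip X
  have h2 := R.map_eval_le X (flip X i) X i fun t ht => (t.eval_flip X ht).symm
  by_cases hq : R.queryProb X i = ⊤
  · simp [hq]
  have hp : ∀ Y, R.map (DecisionTree.eval Y) true ≠ ⊤ := fun Y => PMF.apply_ne_top _ _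
  refine ENNReal.ofReal_le_of_le_toReal (h.trans ?_)
  have h1' := ENNReal.toReal_mono (ENNReal.add_ne_top.2 ⟨hp _, hq⟩) h1
  have h2' := ENNReal.toReal_mono (ENNReal.add_ne_top.2 ⟨hp _, hq⟩) h2
  rw [ENNReal.toReal_add (hp _) hq] at h1' h2'
  rw [abs_le]
  constructor <;> simp only [acceptProb] <;> linarith

theorem Lambda_le_R2 (hn : 1 ≤ n) {ε : ℝ} (hε : 0 < ε) :
    ENNReal.ofReal (1 / 3 * (Lambda n : ℝ)) ≤ (R2 n ε : ENNReal) := by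
  rw [R2, ENat.toENNReal_iInf]
  refine le_iInf fun R => ?_
  rw [ENat.toENNReal_iInf]
  refine le_iInf fun hR => ?_
  obtain ⟨X, S, hS, h⟩ := hR.exists_sensitive hn hε
  refine le_trans ?_ (R.sum_queryProb_le X S)
  calc ENNReal.ofReal (1 / 3 * (Lambda n : ℝ)) ≤ ENNReal.ofReal (#S * (1 / 3)) :=
        ENNReal.ofReal_le_ofReal (by
          have : (Lambda n : ℝ) ≤ #S := by exact_mod_cast hS
          linarith)
    _ = ∑ i ∈ S, ENNReal.ofReal (1 / 3) := by
        rw [sum_const, nsmul_eq_mul, ENNReal.ofReal_mul (Nat.cast_nonneg _),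
          ENNReal.ofReal_natCast]
    _ ≤ _ := sum_le_sum fun i hi => R.third_le_queryProb X i (h i hi)

end Randomized

/-! ### The quantum lower bound -/

section L2

variable {ι : Type*} [Fintype ι]

/-- The Euclidean norm of a vector of amplitudes. -/
noncomputable def l2norm (v : ι → ℂ) : ℝ := ‖WithLp.toLp 2 v‖

lemma l2norm_nonneg (v : ι → ℂ) : 0 ≤ l2norm v := norm_nonneg _

lemma l2norm_add_le (v w : ι → ℂ) : l2norm (v + w) ≤ l2norm v + l2norm w := by
  rw [l2norm, WithLp.toLp_add]
  exact norm_add_le _ _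

lemma l2norm_sub_le (v w : ι → ℂ) : l2norm (v - w) ≤ l2norm v + l2norm w := by
  rw [l2norm, WithLp.toLp_sub]
  exact norm_sub_le _ _

lemma abs_l2norm_sub_le (v w : ι → ℂ) : |l2norm v - l2norm w| ≤ l2norm (v - w) := by
  rw [l2norm, l2norm, l2norm, WithLp.toLp_sub]
  exact abs_norm_sub_norm_le _ _

lemma l2norm_sq (v : ι → ℂ) : l2norm v ^ 2 = ∑ s, ‖v s‖ ^ 2 := by
  rw [l2norm, EuclideanSpace.norm_sq_eq]

lemma l2norm_eq_of_sum_eq {v w : ι → ℂ} (h : ∑ s, ‖v s‖ ^ 2 = ∑ s, ‖w s‖ ^ 2) :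
    l2norm v = l2norm w := by
  rw [← l2norm_sq, ← l2norm_sq] at h
  exact (sq_eq_sq₀ (l2norm_nonneg _) (l2norm_nonneg _)).1 h

lemma l2norm_unitary_mulVec [DecidableEq ι] (U : Matrix.unitaryGroup ι ℂ) (v : ι → ℂ) :
    l2norm (U.val.mulVec v) = l2norm v := by
  have key : ∀ w : ι → ℂ, ((∑ s, ‖w s‖ ^ 2 : ℝ) : ℂ) = star w ⬝ᵥ w := fun w => by
    simp [dotProduct, Complex.conj_mul']
  refine l2norm_eq_of_sum_eq (Complex.ofReal_injective ?_)
  have hU : U.val.conjTranspose * U.val = 1 := Matrix.mem_unitaryGroup_iff'.1 U.2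
  rw [key, key, Matrix.star_mulVec, ← Matrix.dotProduct_mulVec, Matrix.mulVec_mulVec, hU,
    Matrix.one_mulVec]

lemma l2norm_indicator_sq (P : ι → Prop) [DecidablePred P] (v : ι → ℂ) :
    l2norm ({s | P s}.indicator v) ^ 2 = ∑ s, if P s then ‖v s‖ ^ 2 else 0 := by
  rw [l2norm_sq]
  refine sum_congr rfl fun s _ => ?_
  by_cases h : P s <;> simp [h]

lemma l2norm_indicator_le (A : Set ι) (v : ι → ℂ) : l2norm (A.indicator v) ≤ l2norm v := by
  classical
  refine (sq_le_sq₀ (l2norm_nonneg _) (l2norm_nonneg _)).1 ?_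
  refine (l2norm_indicator_sq (· ∈ A) v).trans_le ?_
  rw [l2norm_sq]
  refine sum_le_sum fun s _ => ?_
  split_ifs
  · exact le_rfl
  · positivity

end L2

/-! ### Query weights and the hybrid argument -/

section Quantum

variable {n d : ℕ}

lemma oracle_sub (X : Input n) (ψ φ : BasisState n d → ℂ) :
    oracle X (ψ - φ) = oracle X ψ - oracle X φ := rfl

lemma l2norm_oracle (X : Input n) (ψ : BasisState n d → ℂ) : l2norm (oracle X ψ) = l2norm ψ := by
  have hσ : Function.Involutive
      (fun s : BasisState n d => ((s.1, xor s.2.1 (X s.1), s.2.2) : BasisState n d)) :=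
    fun s => by simp
  exact l2norm_eq_of_sum_eq (Equiv.sum_comp hσ.toPerm fun s => ‖ψ s‖ ^ 2)

/-- The part of a state in which the query register holds the index `i`. -/
noncomputable def queryPart (i : Fin n) (ψ : BasisState n d → ℂ) : BasisState n d → ℂ :=
  {s : BasisState n d | s.1 = i}.indicator ψ

lemma oracle_sub_oracle_flip (X : Input n) (i : Fin n) (ψ : BasisState n d → ℂ) :
    oracle X ψ - oracle (flip X i) ψ =
      oracle X (queryPart i ψ) - oracle (flip X i) (queryPart i ψ) := by
  ext ⟨j, b, z⟩
  by_cases h : j = i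
  · simp [oracle, queryPart, h]
  · simp [oracle, queryPart, h, flip_of_ne X h]

lemma l2norm_oracle_sub_oracle_flip_le (X : Input n) (i : Fin n) (ψ : BasisState n d → ℂ) :
    l2norm (oracle X ψ - oracle (flip X i) ψ) ≤ 2 * l2norm (queryPart i ψ) := by
  rw [oracle_sub_oracle_flip]
  refine (l2norm_sub_le _ _).trans_eq ?_
  rw [l2norm_oracle, l2norm_oracle, two_mul]

lemma sum_l2norm_queryPart_sq (ψ : BasisState n d → ℂ) :
    ∑ i, l2norm (queryPart i ψ) ^ 2 = l2norm ψ ^ 2 := by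
  have h : ∀ i, l2norm (queryPart i ψ) ^ 2 = ∑ s, if s.1 = i then ‖ψ s‖ ^ 2 else 0 := fun i =>
    l2norm_indicator_sq (fun s : BasisState n d => s.1 = i) ψ
  simp only [h, l2norm_sq]
  rw [sum_comm]
  simp

namespace QuantumAlg

variable (A : QuantumAlg n) (X : Input n)

lemma l2norm_state (k : ℕ) : l2norm (A.state X k) = 1 := by
  induction k with
  | zero =>
    rw [state, l2norm_unitary_mulVec, l2norm]
    simp
  | succ k ih => rw [state, l2norm_unitary_mulVec, l2norm_oracle, ih]

/-- Unitaries and queries preserve distances, so errors only add. Each query contributes twice the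
weight on `i`, measured along the run on `X` alone. -/
lemma l2norm_state_sub_state_flip_le (i : Fin n) (k : ℕ) :
    l2norm (A.state X k - A.state (flip X i) k) ≤
      2 * ∑ t ∈ range k, l2norm (queryPart i (A.state X t)) := by
  induction k with
  | zero => simp [state, l2norm]
  | succ k ih =>
    have h : oracle X (A.state X k) - oracle (flip X i) (A.state (flip X i) k) =
        (oracle X (A.state X k) - oracle (flip X i) (A.state X k)) +
          oracle (flip X i) (A.state X k - A.state (flip X i) k) := by
      rw [oracle_sub]; abel
    rw [state, state, ← Matrix.mulVec_sub, l2norm_unitary_mulVec, h, sum_range_succ, mul_add]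
    refine (l2norm_add_le _ _).trans ?_
    rw [l2norm_oracle, add_comm]
    exact add_le_add ih (l2norm_oracle_sub_oracle_flip_le X i _)

lemma acceptProb_eq : A.acceptProb X =
    l2norm ({s : BasisState n A.d | A.out s.2.2 = true}.indicator (A.state X A.T)) ^ 2 :=
  (l2norm_indicator_sq (fun s : BasisState n A.d => A.out s.2.2 = true) (A.state X A.T)).symm

/-- The probabilities are squares of norms at most 1; the 2 bounds the sum of these norms. -/
lemma abs_acceptProb_sub_le (Y : Input n) :
    |A.acceptProb X - A.acceptProb Y| ≤ 2 * l2norm (A.state X A.T - A.state Y A.T) := by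
  rw [acceptProb_eq, acceptProb_eq]
  set B := {s : BasisState n A.d | A.out s.2.2 = true}
  have h1 : ∀ Z, l2norm (B.indicator (A.state Z A.T)) ≤ 1 := fun Z =>
    (l2norm_indicator_le _ _).trans_eq (A.l2norm_state Z A.T)
  have h2 : |l2norm (B.indicator (A.state X A.T)) - l2norm (B.indicator (A.state Y A.T))| ≤
      l2norm (A.state X A.T - A.state Y A.T) := by
    refine (abs_l2norm_sub_le _ _).trans ?_
    rw [← Set.indicator_sub']
    exact l2norm_indicator_le _ _
  rw [sq_sub_sq, abs_mul,
    abs_of_nonneg (add_nonneg (l2norm_nonneg _) (l2norm_nonneg _))]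
  exact mul_le_mul (by linarith [h1 X, h1 Y]) h2 (abs_nonneg _) zero_le_two

/-- The hybrid argument: if changing any single bit in `S` changes the acceptance probability
by `1/3`, then the algorithm makes at least `√|S| / 12` queries. -/
lemma card_le_of_sensitive (S : Finset (Fin n))
    (h : ∀ i ∈ S, 1 / 3 ≤ |A.acceptProb X - A.acceptProb (flip X i)|) :
    (#S : ℝ) ≤ (12 * A.T) ^ 2 := by
  let w : ℕ → Fin n → ℝ := fun t i => l2norm (queryPart i (A.state X t))
  -- A jump of 1/3 is at most 4 ∑ w, so ∑ w ≥ 1/12; Cauchy–Schwarz over the `T` times squares this.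
  have h1 : ∀ i ∈ S, 1 ≤ 144 * (A.T * ∑ t ∈ range A.T, w t i ^ 2) := fun i hi => by
    have h2 := (h i hi).trans ((A.abs_acceptProb_sub_le X _).trans
      (mul_le_mul_of_nonneg_left (A.l2norm_state_sub_state_flip_le X i A.T) zero_le_two))
    have h3 : 1 / 12 ≤ ∑ t ∈ range A.T, w t i := by linarith
    have h4 := sq_sum_le_card_mul_sum_sq (s := range A.T) (f := fun t => w t i)
    rw [card_range] at h4
    nlinarith
  calc (#S : ℝ) = ∑ i ∈ S, (1 : ℝ) := by simp
    _ ≤ ∑ i ∈ S, 144 * (A.T * ∑ t ∈ range A.T, w t i ^ 2) := sum_le_sum h1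
    _ ≤ ∑ i, 144 * (A.T * ∑ t ∈ range A.T, w t i ^ 2) :=
        sum_le_univ_sum_of_nonneg fun i => by positivity
    _ = (12 * A.T) ^ 2 := by
        -- At each time the squared weights sum to 1 over `i`, leaving 144·T·T.
        rw [← mul_sum, ← mul_sum, sum_comm]
        simp only [w, sum_l2norm_queryPart_sq, l2norm_state]
        simp
        ring

end QuantumAlg

theorem sqrt_Lambda_le_Q2 (hn : 1 ≤ n) {ε : ℝ} (hε : 0 < ε) :
    ENNReal.ofReal (1 / 12 * √(Lambda n : ℝ)) ≤ (Q2 n ε : ENNReal) := by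
  rw [Q2, ENat.toENNReal_iInf]
  refine le_iInf fun A => ?_
  rw [ENat.toENNReal_iInf]
  refine le_iInf fun hA => ?_
  obtain ⟨X, S, hS, h⟩ := hA.exists_sensitive hn hε
  rw [ENat.toENNReal_coe, ← ENNReal.ofReal_natCast]
  refine ENNReal.ofReal_le_ofReal ?_
  have h1 : √(Lambda n : ℝ) ≤ 12 * A.T :=
    Real.sqrt_le_iff.2 ⟨by positivity,
      le_trans (by exact_mod_cast hS) (A.card_le_of_sensitive X S h)⟩
  linarith

end Quantum

/-! ### Explicit bounds -/

lemma log_two_mul_le_two_mul_log_two_mul_sqrt {x : ℝ} (hx : 0 < x) :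
    Real.log (2 * x) ≤ 2 * Real.log 2 * √x := by
  have hs : 0 < √x := Real.sqrt_pos.2 hx
  -- Splitting 2x = (2√x/3)² · 9/2 cancels the constants and gives log(2x) ≤ (4/3)√x; then log 2 >
  -- 2/3 suffices.
  have h1 : Real.log (√x * (2 / 3)) ≤ √x * (2 / 3) - 1 := Real.log_le_sub_one_of_pos (by positivity)
  have h2 : Real.log (9 / 2) ≤ 2 := by
    rw [Real.log_le_iff_le_exp (by norm_num)]
    have := Real.quadratic_le_exp_of_nonneg (x := 2) (by norm_num)
    linarith
  have h3 : Real.log (2 * x) = 2 * Real.log (√x * (2 / 3)) + Real.log (9 / 2) := by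
    rw [← Real.log_rpow (by positivity), ← Real.log_mul (by positivity) (by norm_num)]
    congr 1
    rw [Real.rpow_two, mul_pow, Real.sq_sqrt hx.le]
    ring
  have h4 := Real.log_two_gt_d9
  nlinarith

lemma log_le_two_mul_Lambda {n : ℕ} (hn : 1 ≤ n) : Real.log n ≤ 2 * (Lambda n : ℝ) := by
  have hx : (0 : ℝ) < n := by exact_mod_cast hn
  have h1 := log_two_mul_le_two_mul_log_two_mul_sqrt hx
  have h2 := sqrt_le_Lambda hn
  have h3 : Real.log n ≤ Real.log (2 * n) := Real.log_le_log hx (by linarith)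
  have h4 := Real.log_two_lt_d9
  nlinarith [Real.sqrt_nonneg (n : ℝ)]

lemma logb_bound_le_Lambda {n : ℕ} (hn : 2 ≤ n) :
    1 / 2 * Real.logb 2 n - 1 / 2 * Real.logb 2 (Real.logb 2 n) + 1 / 2 ≤ (Lambda n : ℝ) := by
  have hx : (2 : ℝ) ≤ n := by exact_mod_cast hn
  have h1 := log_two_mul_le_two_mul_log_two_mul_sqrt (x := n) (by linarith)
  have h2 := sqrt_le_Lambda (n := n) (by omega)
  -- For `n ≥ 2` the iterated logarithm only weakens the claim and can be dropped.
  have h3 : 0 ≤ Real.logb 2 (Real.logb 2 n) := by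
    refine Real.logb_nonneg one_lt_two ?_
    rw [Real.le_logb_iff_rpow_le one_lt_two (by linarith)]
    simpa using hx
  have h4 : 1 + Real.logb 2 n ≤ 2 * √(n : ℝ) := by
    have h5 : Real.log 2 * (1 + Real.logb 2 n) = Real.log (2 * n) := by
      rw [Real.log_mul (by norm_num) (by linarith), Real.logb]
      field_simp
    refine le_of_mul_le_mul_left ?_ (Real.log_pos one_lt_two)
    linarith
  linarith

end WeakParity

theorem mainTheorem3 :
    -- randomized and quantum lower bounds in terms of `Λ(n)`, uniform in `n` and `ε`
    (∃ c : ℝ, 0 < c ∧ ∀ n : ℕ, 1 ≤ n → ∀ ε : ℝ, 0 < ε →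
      ENNReal.ofReal (c * (WeakParity.Lambda n : ℝ)) ≤ (WeakParity.R2 n ε : ENNReal)) ∧
    (∃ c : ℝ, 0 < c ∧ ∀ n : ℕ, 1 ≤ n → ∀ ε : ℝ, 0 < ε →
      ENNReal.ofReal (c * Real.sqrt (WeakParity.Lambda n : ℝ)) ≤
        (WeakParity.Q2 n ε : ENNReal)) ∧
    -- the lower bound on `Λ(n)`
    (∀ n : ℕ, 2 ≤ n →
      1 / 2 * Real.logb 2 n - 1 / 2 * Real.logb 2 (Real.logb 2 n) + 1 / 2 ≤
        (WeakParity.Lambda n : ℝ)) ∧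
    -- the resulting lower bounds in terms of `n`, uniform in `n` and `ε`
    (∃ c : ℝ, 0 < c ∧ ∀ n : ℕ, 1 ≤ n → ∀ ε : ℝ, 0 < ε →
      ENNReal.ofReal (c * Real.log n) ≤ (WeakParity.R2 n ε : ENNReal)) ∧
    (∃ c : ℝ, 0 < c ∧ ∀ n : ℕ, 1 ≤ n → ∀ ε : ℝ, 0 < ε →
      ENNReal.ofReal (c * Real.sqrt (Real.log n)) ≤ (WeakParity.Q2 n ε : ENNReal)) := by
  refine ⟨⟨1 / 3, by norm_num, fun n hn ε hε => WeakParity.Lambda_le_R2 hn hε⟩,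
    ⟨1 / 12, by norm_num, fun n hn ε hε => WeakParity.sqrt_Lambda_le_Q2 hn hε⟩,
    fun n hn => WeakParity.logb_bound_le_Lambda hn,
    ⟨1 / 6, by norm_num, fun n hn ε hε => ?_⟩, ⟨1 / 24, by norm_num, fun n hn ε hε => ?_⟩⟩
  · refine le_trans (ENNReal.ofReal_le_ofReal ?_) (WeakParity.Lambda_le_R2 hn hε)
    linarith [WeakParity.log_le_two_mul_Lambda hn]
  · refine le_trans (ENNReal.ofReal_le_ofReal ?_) (WeakParity.sqrt_Lambda_le_Q2 hn hε)
    -- The factor 2 rounds up √2, hence 1/24 = (1/12)/2.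
    have h : √(Real.log n) ≤ 2 * √(WeakParity.Lambda n : ℝ) := by
      refine Real.sqrt_le_iff.2 ⟨by positivity, ?_⟩
      rw [mul_pow, Real.sq_sqrt (Nat.cast_nonneg _)]
      linarith [WeakParity.log_le_two_mul_Lambda hn,
        (Nat.cast_nonneg (WeakParity.Lambda n) : (0 : ℝ) ≤ _)]
    linarith
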